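/- Let $d, d_\theta, k$ be positive integers and let $\mathbb{S}^m$ denote the unit sphere of $\mathbb{R}^{m+1}$. Let $h\colon \mathbb{S}^d\to\mathbb{S}^{d_\theta}$ be continuous and injective. A spherical tree with $k$ edges in $\mathbb{S}^{d_\theta}$ is a tuple $\mathcal{T}=(x;y_1,\dots,y_k)$ with root $x\in\mathbb{S}^{d_\theta}$ and directions $y_i\in\mathbb{S}^{d_\theta}$, $\langle x,y_i\rangle=0$; as a metric space it is the gluing of $k$ copies of $[0,\pi]$ (the edges, with points $(t,i)$, $t\in[0,\pi]$) at the root $t=0$, with the tree metric $d_{\mathcal T}((s,i),(t,i))=|s-t|$ and $d_{\mathcal T}((s,i),(t,j))=s+t$ for $i\ne j$. Let $\mathbb{T}^{d_\theta}_k$ be the space of these trees, with the topology induced from $(\mathbb{S}^{d_\theta})^{1+k}$, and let $\sigma$ be the probability distribution on $\mathbb{T}^{d_\theta}_k$ for which $x$ is uniform on $\mathbb{S}^{d_\theta}$ and, given $x$, the directions $y_1,\dots,y_k$ are independent and uniform on the unit sphere of $x^\perp$. Let $\alpha\colon \mathbb{S}^{d_\theta}\times\mathbb{T}^{d_\theta}_k\to\Delta_{k-1}$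 be a continuous map into the standard simplex (a splitting map). For a Borel probability measure $\mu$ on $\mathbb{S}^d$, its Spatial Spherical Radon Transform $\mathcal{H}^\alpha_{\mathcal T}\mu$ is the probability measure on $\mathcal{T}$ given by $$\int_{\mathcal T}\varphi\,d(\mathcal{H}^\alpha_{\mathcal T}\mu)=\sum_{i=1}^k\int_{\mathbb{S}^d}\varphi\bigl(\arccos\langle x,h(y)\rangle,\,i\bigr)\,\alpha(h(y),\mathcal{T})_i\,d\mu(y);$$ for $\mu$ with density $f$ this is the formula $(t,i)\mapsto\int_{\mathbb{S}^d} f(y)\,\alpha(h(y),\mathcal T)_i\,\delta(t-\arccos\langle x,h(y)\rangle)\,dy$. Let $\mathrm{W}$ be the $1$-Wasserstein distance on $\mathcal{T}$ with respect to $d_{\mathcal T}$, i.e. the infimum of $\int d_{\mathcal T}\,d\gamma$ over all couplings $\gamma$, and put $$\mathrm{SpatialSTSW}(\mu,\nu)=\int_{\mathbb{T}^{d_\theta}_k}\mathrm{W}\bigl(\mathcal{H}^\alpha_{\mathcal T}\mu,\mathcal{H}^\alpha_{\mathcal T}\nu\bigr)\,d\sigma(\mathcal{T}).$$ **Theorem.**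 SpatialSTSW is a well-defined metric on the set $\mathcal{P}(\mathbb{S}^d)$ of all Borel probability measures on $\mathbb{S}^d$: the integrand is a finite and measurable function of $\mathcal{T}$, and $\mathrm{SpatialSTSW}$ is finite and non-negative, vanishes exactly if $\mu=\nu$, is symmetric, and satisfies the triangle inequality. -/

import Mathlib

open MeasureTheory Set
open scoped ENNReal Real

noncomputable section

/-- The unit sphere `S^d` of `ℝ^(d+1)`. -/
abbrev USphere (d : ℕ) : Type :=
  Metric.sphere (0 : EuclideanSpace ℝ (Fin (d + 1))) 1

/-- The space of spherical trees with `k` edges in `S^d`. A tree is given by its root `x ∈ S^d` and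
the directions `y₁, …, y_k` of its edges, which are unit vectors of the hyperplane orthogonal to
`x`. The topology and the σ-algebra are those induced from `S^d × (S^d)^k`. -/
abbrev SphericalTree (d k : ℕ) : Type :=
  {p : USphere d × (Fin k → USphere d) //
    ∀ i, inner ℝ (p.1 : EuclideanSpace ℝ (Fin (d + 1))) (p.2 i) = 0}

/-- The root of a spherical tree. -/
def SphericalTree.root {d k : ℕ} (T : SphericalTree d k) : USphere d := T.1.1

/-- A point of one of `k` spherical rays, before gluing: the index of the ray and the coordinate
`t ∈ [0, π]` on it, which is the spherical distance to the root. -/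
structure RayPoint (k : ℕ) where
  edge : Fin k
  coord : ℝ
  mem : coord ∈ Icc 0 π

/-- The tree distance: along the ray for two points of the same ray, through the root otherwise. -/
instance RayPoint.instPseudoMetricSpace (k : ℕ) : PseudoMetricSpace (RayPoint k) where
  dist p q := if p.edge = q.edge then |p.coord - q.coord| else p.coord + q.coord
  dist_self p := by simp
  dist_comm p q := by
    simp only [eq_comm (a := p.edge), abs_sub_comm p.coord, add_comm p.coord]
  dist_triangle p q r := by
    have hp := p.mem.1
    have hq := q.mem.1
    have hr := r.mem.1
    split_ifs <;> grind

/-- The metric space underlying a spherical tree with `k` edges: the gluing of `k` rays `[0, π]` at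
the root `t = 0`, with the tree metric. (Two points of `RayPoint k` have distance `0` exactly if
they are equal or both are the root.) In the coordinates `(t, i)` this space is the same for all
trees with `k` edges. -/
def TreeSpace (k : ℕ) : Type := SeparationQuotient (RayPoint k)

instance TreeSpace.instMetricSpace (k : ℕ) : MetricSpace (TreeSpace k) :=
  inferInstanceAs (MetricSpace (SeparationQuotient (RayPoint k)))

instance TreeSpace.instMeasurableSpace (k : ℕ) : MeasurableSpace (TreeSpace k) := borel _

instance TreeSpace.instBorelSpace (k : ℕ) : BorelSpace (TreeSpace k) := ⟨rfl⟩

/-- The point with coordinate `t` on the `i`-th ray. -/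
def TreeSpace.mk {k : ℕ} (i : Fin k) (t : ℝ) (ht : t ∈ Icc 0 π) : TreeSpace k :=
  SeparationQuotient.mk (⟨i, t, ht⟩ : RayPoint k)

theorem TreeSpace.dist_mk {k : ℕ} (i j : Fin k) (s t : ℝ) (hs : s ∈ Icc 0 π) (ht : t ∈ Icc 0 π) :
    dist (TreeSpace.mk i s hs) (TreeSpace.mk j t ht) = if i = j then |s - t| else s + t :=
  rfl

/-- The `1`-Wasserstein distance of two measures on a metric space: the infimum, over all couplings,
of the expected distance. -/
def wassersteinDist {X : Type*} [MetricSpace X] [MeasurableSpace X] (μ ν : Measure X) : ℝ≥0∞ :=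
  ⨅ (γ : Measure (X × X)) (_ : γ.map Prod.fst = μ ∧ γ.map Prod.snd = ν), ∫⁻ z, edist z.1 z.2 ∂γ

/-- The map of `S^d` to the `i`-th edge of the tree `T` in `S^n`, `y ↦ (arccos ⟨x, h y⟩, i)`,
where `x` is the root of `T`. -/
def treeProj {d n k : ℕ} (h : USphere d → USphere n) (T : SphericalTree n k) (i : Fin k)
    (y : USphere d) : TreeSpace k :=
  TreeSpace.mk i
    (Real.arccos (inner ℝ (T.root : EuclideanSpace ℝ (Fin (n + 1))) (h y)))
    ⟨Real.arccos_nonneg _, Real.arccos_le_pi _⟩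

/-- The Spatial Spherical Radon Transform of a measure `μ` on `S^d` along the tree `T`, as a measure
on `T`: the part `α(h(y), T)ᵢ μ(dy)` of `μ` is projected to the `i`-th edge. For `μ = f dy` this is
the formula `(t, i) ↦ ∫ f(y) α(h(y), T)ᵢ δ(t - arccos ⟨x, h(y)⟩) dy`. -/
def spatialRadon {d n k : ℕ} (h : USphere d → USphere n)
    (α : USphere n × SphericalTree n k → stdSimplex ℝ (Fin k)) (T : SphericalTree n k)
    (μ : Measure (USphere d)) : Measure (TreeSpace k) :=
  ∑ i : Fin k,
    (μ.withDensity fun y => ENNReal.ofReal ((α (h y, T) : Fin k → ℝ) i)).map (treeProj h T i)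

/-- The uniform probability distribution on the unit sphere of `ℝ^m`. -/
def uniformUnitSphere (m : ℕ) : Measure (Metric.sphere (0 : EuclideanSpace ℝ (Fin m)) 1) :=
  ((volume : Measure (EuclideanSpace ℝ (Fin m))).toSphere univ)⁻¹ •
    (volume : Measure (EuclideanSpace ℝ (Fin m))).toSphere

/-- The pole `e₀ = (1, 0, …, 0)` of `S^n`. -/
def pole (n : ℕ) : EuclideanSpace ℝ (Fin (n + 1)) := EuclideanSpace.single 0 1

/-- The embedding `z ↦ (0, z)` of `ℝ^n` as the hyperplane orthogonal to the pole of `S^n`. -/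
def equator {n : ℕ} (z : EuclideanSpace ℝ (Fin n)) : EuclideanSpace ℝ (Fin (n + 1)) :=
  WithLp.toLp 2 (Fin.cons 0 z.ofLp)

/-- The linear isometry of `ℝ^(n+1)` that exchanges the pole with `x ∈ S^n`; it is the reflection
in the hyperplane orthogonal to `e₀ - x`. It maps the hyperplane orthogonal to the pole onto the
hyperplane orthogonal to `x`. -/
def poleTo {n : ℕ} (x : USphere n) :
    EuclideanSpace ℝ (Fin (n + 1)) ≃ₗᵢ[ℝ] EuclideanSpace ℝ (Fin (n + 1)) :=
  (ℝ ∙ (pole n - (x : EuclideanSpace ℝ (Fin (n + 1)))))ᗮ.reflection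

theorem poleTo_pole {n : ℕ} (x : USphere n) : poleTo x (pole n) = x := by
  unfold poleTo
  apply Submodule.reflection_sub
  simp [pole]

theorem norm_equator {n : ℕ} (z : EuclideanSpace ℝ (Fin n)) : ‖equator z‖ = ‖z‖ := by
  simp [equator, EuclideanSpace.norm_eq, Fin.sum_univ_succ]

theorem inner_pole_equator {n : ℕ} (z : EuclideanSpace ℝ (Fin n)) :
    inner ℝ (pole n) (equator z) = 0 := by
  simp [pole, equator, PiLp.inner_apply]

/-- The spherical tree with root `x` whose edges have the directions that correspond to
`z₁, …, z_k ∈ S^(n-1)` under the isometry `poleTo x ∘ equator` of `ℝ^n` onto the hyperplane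
orthogonal to `x`. -/
def treeOf {n k : ℕ}
    (p : USphere n × (Fin k → Metric.sphere (0 : EuclideanSpace ℝ (Fin n)) 1)) :
    SphericalTree n k :=
  ⟨(p.1, fun i => ⟨poleTo p.1 (equator (p.2 i)), by
      rw [mem_sphere_zero_iff_norm, LinearIsometryEquiv.norm_map, norm_equator]
      exact norm_eq_of_mem_sphere (p.2 i)⟩), fun i => by
      have := (poleTo p.1).inner_map_map (pole n) (equator (p.2 i))
      rwa [poleTo_pole, inner_pole_equator] at this⟩

/-- The tree sampling distribution `σ` on the space of spherical trees with `k` edges in `S^n`: the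
root `x` is uniform on `S^n` and, given `x`, the directions of the edges are independent and uniform
on the unit sphere of the hyperplane orthogonal to `x`. -/
def treeSampling (n k : ℕ) : Measure (SphericalTree n k) :=
  ((uniformUnitSphere (n + 1)).prod (Measure.pi fun _ : Fin k => uniformUnitSphere n)).map treeOf

/-- The Spatial Spherical Tree-Sliced Wasserstein distance. -/
def spatialSTSW {d n k : ℕ} (h : USphere d → USphere n)
    (α : USphere n × SphericalTree n k → stdSimplex ℝ (Fin k))
    (μ ν : ProbabilityMeasure (USphere d)) : ℝ≥0∞ :=
  ∫⁻ T, wassersteinDist (spatialRadon h α T μ) (spatialRadon h α T ν) ∂(treeSampling n k)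

end

/-!
Projecting a tree to the cosine of the distance to its root turns the Radon transform of `μ` along
a tree with root `x` into the law of `⟨x, h y⟩` under `μ`, because the splitting weights sum to one.
If the distance of `μ` and `ν` vanishes, these laws agree for almost every `x`, hence so do the
characteristic functions of `h_* μ` and `h_* ν` on almost every line through the origin, and by
continuity on every line. So `h_* μ = h_* ν`, and `μ = ν` because `h` is injective.

The tree space is compact, hence so is the space of couplings: the Wasserstein distance is attained
and is lower semicontinuous for the weak topology. This gives both its definiteness and the
measurability of the integrand.
-/

section Couplings

variable {X Y Z : Type*} [MeasurableSpace X] [MeasurableSpace Y] [MeasurableSpace Z]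

theorem exists_measure_map_eq_of_snd_eq_fst [StandardBorelSpace Z] [Nonempty Z]
    {γ₁ : Measure (X × Y)} {γ₂ : Measure (Y × Z)} [IsFiniteMeasure γ₁] [IsFiniteMeasure γ₂]
    (h : γ₁.snd = γ₂.fst) :
    ∃ γ : Measure ((X × Y) × Z), γ.fst = γ₁ ∧ γ.map (fun z => (z.1.2, z.2)) = γ₂ := by
  refine ⟨γ₁.compProd (γ₂.condKernel.comap Prod.snd measurable_snd), Measure.fst_compProd _ _, ?_⟩
  nth_rw 2 [← γ₂.disintegrate γ₂.condKernel]
  ext s hs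
  rw [Measure.map_apply (by fun_prop) hs, Measure.compProd_apply (hs.preimage (by fun_prop)),
    Measure.compProd_apply hs, ← h, Measure.snd,
    lintegral_map (ProbabilityTheory.Kernel.measurable_kernel_prodMk_left hs) measurable_snd]
  rfl

end Couplings

section Wasserstein

theorem ediam_univ_lt_top (X : Type*) [PseudoMetricSpace X] [BoundedSpace X] :
    Metric.ediam (univ : Set X) < ∞ :=
  (Metric.isBounded_iff_ediam_ne_top.1 (Bornology.IsBounded.all univ)).lt_top

variable {X : Type*} [MetricSpace X] [MeasurableSpace X]

theorem wassersteinDist_le {μ ν : Measure X} {γ : Measure (X × X)} (h₁ : γ.map Prod.fst = μ)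
    (h₂ : γ.map Prod.snd = ν) : wassersteinDist μ ν ≤ ∫⁻ z, edist z.1 z.2 ∂γ :=
  iInf₂_le γ ⟨h₁, h₂⟩

theorem wassersteinDist_le_ediam_univ (μ ν : Measure X) [IsProbabilityMeasure μ]
    [IsProbabilityMeasure ν] : wassersteinDist μ ν ≤ Metric.ediam (univ : Set X) :=
  calc wassersteinDist μ ν ≤ ∫⁻ z, edist z.1 z.2 ∂μ.prod ν := wassersteinDist_le (by simp) (by simp)
    _ ≤ ∫⁻ _, Metric.ediam (univ : Set X) ∂μ.prod ν :=
      lintegral_mono fun _ => Metric.edist_le_ediam_of_mem (mem_univ _) (mem_univ _)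
    _ = Metric.ediam univ := by simp

theorem wassersteinDist_lt_top [BoundedSpace X] (μ ν : Measure X) [IsProbabilityMeasure μ]
    [IsProbabilityMeasure ν] : wassersteinDist μ ν < ∞ :=
  (wassersteinDist_le_ediam_univ μ ν).trans_lt (ediam_univ_lt_top X)

section SecondCountable

variable [OpensMeasurableSpace X] [SecondCountableTopology X]

theorem wassersteinDist_self (μ : Measure X) : wassersteinDist μ μ = 0 := by
  have h_diag : Measurable fun x : X => (x, x) := by fun_prop
  refine nonpos_iff_eq_zero.1 ?_
  calc wassersteinDist μ μ ≤ ∫⁻ z, edist z.1 z.2 ∂μ.map fun x => (x, x) := by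
        refine wassersteinDist_le ?_ ?_ <;> rw [Measure.map_map (by fun_prop) h_diag] <;>
          exact Measure.map_id
    _ = 0 := by rw [lintegral_map (by fun_prop) h_diag]; simp

theorem wassersteinDist_comm (μ ν : Measure X) : wassersteinDist μ ν = wassersteinDist ν μ := by
  have h_le (μ ν : Measure X) : wassersteinDist μ ν ≤ wassersteinDist ν μ := by
    refine le_iInf₂ fun γ hγ => ?_
    calc wassersteinDist μ ν ≤ ∫⁻ z, edist z.1 z.2 ∂γ.map Prod.swap := by
          refine wassersteinDist_le ?_ ?_ <;> rw [Measure.map_map (by fun_prop) measurable_swap]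
          exacts [hγ.2, hγ.1]
      _ = ∫⁻ z, edist z.1 z.2 ∂γ := by
          rw [lintegral_map (by fun_prop) measurable_swap]
          simp only [Prod.fst_swap, Prod.snd_swap, edist_comm]
  exact le_antisymm (h_le μ ν) (h_le ν μ)

theorem wassersteinDist_le_lintegral_add_lintegral [StandardBorelSpace X] [Nonempty X]
    {γ₁ γ₂ : Measure (X × X)} [IsFiniteMeasure γ₁] [IsFiniteMeasure γ₂] (h : γ₁.snd = γ₂.fst) :
    wassersteinDist γ₁.fst γ₂.snd ≤ ∫⁻ z, edist z.1 z.2 ∂γ₁ + ∫⁻ z, edist z.1 z.2 ∂γ₂ := by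
  obtain ⟨γ, rfl, rfl⟩ := exists_measure_map_eq_of_snd_eq_fst h
  have h_outer : Measurable fun z : (X × X) × X => (z.1.1, z.2) := by fun_prop
  have h_right : Measurable fun z : (X × X) × X => (z.1.2, z.2) := by fun_prop
  calc wassersteinDist γ.fst.fst (γ.map fun z => (z.1.2, z.2)).snd
      ≤ ∫⁻ z, edist z.1 z.2 ∂γ.map fun z => (z.1.1, z.2) := by
        refine wassersteinDist_le ?_ ?_
        · rw [Measure.map_map measurable_fst h_outer, Measure.fst, Measure.fst,
            Measure.map_map measurable_fst measurable_fst]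
          rfl
        · rw [Measure.map_map measurable_snd h_outer, Measure.snd,
            Measure.map_map measurable_snd h_right]
          rfl
    _ ≤ ∫⁻ z, edist z.1.1 z.1.2 + edist z.1.2 z.2 ∂γ := by
        rw [lintegral_map (by fun_prop) h_outer]
        exact lintegral_mono fun z => edist_triangle _ _ _
    _ = ∫⁻ z, edist z.1 z.2 ∂γ.fst + ∫⁻ z, edist z.1 z.2 ∂γ.map fun z => (z.1.2, z.2) := by
        rw [lintegral_add_left (by fun_prop), Measure.fst,
          lintegral_map (by fun_prop) (by fun_prop), lintegral_map (by fun_prop) h_right]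

theorem wassersteinDist_triangle [StandardBorelSpace X] (μ ν ρ : Measure X) [IsFiniteMeasure ν] :
    wassersteinDist μ ρ ≤ wassersteinDist μ ν + wassersteinDist ν ρ := by
  rcases isEmpty_or_nonempty X with hX | hX
  · rw [Subsingleton.elim μ ρ, wassersteinDist_self]
    exact zero_le
  conv_rhs => rw [wassersteinDist, wassersteinDist]
  simp only [ENNReal.iInf_add, ENNReal.add_iInf]
  refine le_iInf₂ fun γ₂ h₂ => le_iInf₂ fun γ₁ h₁ => ?_
  have : IsFiniteMeasure (γ₁.map Prod.snd) := h₁.2 ▸ inferInstance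
  have : IsFiniteMeasure (γ₂.map Prod.fst) := h₂.1 ▸ inferInstance
  have := Measure.isFiniteMeasure_of_map (μ := γ₁) measurable_snd.aemeasurable
  have := Measure.isFiniteMeasure_of_map (μ := γ₂) measurable_fst.aemeasurable
  rw [← h₁.1, ← h₂.2]
  exact wassersteinDist_le_lintegral_add_lintegral (h₁.2.trans h₂.1.symm)

end SecondCountable

end Wasserstein

section WeakTopology

theorem topologicalSpace_probabilityMeasure_eq_generateFrom (X : Type*) [TopologicalSpace X]
    [MeasurableSpace X] [OpensMeasurableSpace X] :
    (inferInstance : TopologicalSpace (ProbabilityMeasure X)) =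
      .generateFrom {s | ∃ f : BoundedContinuousFunction X NNReal, ∃ u : Set ℝ≥0∞, IsOpen u ∧
        (fun μ : ProbabilityMeasure X => ∫⁻ x, f x ∂μ) ⁻¹' u = s} := by
  refine le_antisymm (le_generateFrom ?_) (continuous_id_iff_le.1 ?_)
  · rintro _ ⟨f, u, hu, rfl⟩
    exact hu.preimage (ProbabilityMeasure.continuous_lintegral_boundedContinuousFunction f)
  · exact (@ProbabilityMeasure.continuous_iff_forall_continuous_lintegral
      _ _ _ _ _ (.generateFrom _) _).2 fun f => @Continuous.mk
        _ _ (.generateFrom _) _ _ fun u hu => .basic _ ⟨f, u, hu, rfl⟩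

instance instOpensMeasurableSpaceProbabilityMeasure (X : Type*) [TopologicalSpace X]
    [MeasurableSpace X] [OpensMeasurableSpace X]
    [SecondCountableTopology (ProbabilityMeasure X)] :
    OpensMeasurableSpace (ProbabilityMeasure X) where
  borel_le := by
    rw [borel_eq_generateFrom_of_subbasis (topologicalSpace_probabilityMeasure_eq_generateFrom X)]
    refine MeasurableSpace.generateFrom_le ?_
    rintro _ ⟨f, u, hu, rfl⟩
    have h_meas : Measurable fun μ : ProbabilityMeasure X => ∫⁻ x, f x ∂μ :=
      (Measure.measurable_lintegral (by fun_prop)).comp measurable_subtype_coe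
    exact h_meas hu.measurableSet

end WeakTopology

section OptimalCoupling

variable {X : Type*} [MetricSpace X] [MeasurableSpace X] [BorelSpace X] [CompactSpace X]

theorem continuous_lintegral_edist :
    Continuous fun γ : ProbabilityMeasure (X × X) => ∫⁻ z : X × X, edist z.1 z.2 ∂γ := by
  simp only [edist_nndist]
  exact ProbabilityMeasure.continuous_lintegral_continuousMap
    (⟨fun z => nndist z.1 z.2, by fun_prop⟩ : C(X × X, NNReal))

theorem continuous_map_fst_map_snd :
    Continuous fun γ : ProbabilityMeasure (X × X) =>
      (γ.map (f := Prod.fst) measurable_fst.aemeasurable,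
        γ.map (f := Prod.snd) measurable_snd.aemeasurable) :=
  (ProbabilityMeasure.continuous_map continuous_fst).prodMk
    (ProbabilityMeasure.continuous_map continuous_snd)

theorem exists_optimal_coupling (μ ν : ProbabilityMeasure X) :
    ∃ γ : ProbabilityMeasure (X × X), (γ : Measure (X × X)).map Prod.fst = μ ∧
      (γ : Measure (X × X)).map Prod.snd = ν ∧
        ∫⁻ z : X × X, edist z.1 z.2 ∂γ = wassersteinDist (μ : Measure X) ν := by
  let couplings : Set (ProbabilityMeasure (X × X)) := {γ |
    (γ.map (f := Prod.fst) measurable_fst.aemeasurable,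
      γ.map (f := Prod.snd) measurable_snd.aemeasurable) = (μ, ν)}
  have h_compact : IsCompact couplings :=
    (isClosed_singleton.preimage continuous_map_fst_map_snd).isCompact
  have h_nonempty : couplings.Nonempty := ⟨μ.prod ν, by
    ext1 <;> exact Subtype.ext (by simp)⟩
  obtain ⟨γ, h_marginals, h_min⟩ :=
    h_compact.exists_isMinOn h_nonempty continuous_lintegral_edist.continuousOn
  have h_fst := congrArg Subtype.val (congrArg Prod.fst h_marginals)
  have h_snd := congrArg Subtype.val (congrArg Prod.snd h_marginals)
  refine ⟨γ, h_fst, h_snd, le_antisymm ?_ (wassersteinDist_le h_fst h_snd)⟩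
  refine le_iInf₂ fun γ' h' => ?_
  have : IsProbabilityMeasure (γ'.map Prod.fst) := h'.1 ▸ inferInstance
  have : IsProbabilityMeasure γ' := Measure.isProbabilityMeasure_of_map Prod.fst
  exact h_min (show ⟨γ', this⟩ ∈ couplings from
    Prod.ext (Subtype.ext h'.1) (Subtype.ext h'.2))

theorem eq_of_wassersteinDist_eq_zero {μ ν : Measure X} [IsProbabilityMeasure μ]
    [IsProbabilityMeasure ν] (h : wassersteinDist μ ν = 0) : μ = ν := by
  obtain ⟨γ, h_fst, h_snd, h_cost⟩ :=
    exists_optimal_coupling (⟨μ, ‹_›⟩ : ProbabilityMeasure X) ⟨ν, ‹_›⟩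
  have h_diag : Prod.fst =ᵐ[(γ : Measure (X × X))] Prod.snd := by
    filter_upwards [(lintegral_eq_zero_iff (by fun_prop)).1 (h_cost.trans h)] with z hz
    exact edist_eq_zero.1 hz
  exact h_fst.symm.trans ((Measure.map_congr h_diag).trans h_snd)

theorem lowerSemicontinuous_wassersteinDist :
    LowerSemicontinuous fun p : ProbabilityMeasure X × ProbabilityMeasure X =>
      wassersteinDist (p.1 : Measure X) p.2 := by
  refine lowerSemicontinuous_iff_isClosed_preimage.2 fun c => ?_
  have h_compact :
      IsCompact {γ : ProbabilityMeasure (X × X) | ∫⁻ z : X × X, edist z.1 z.2 ∂γ ≤ c} :=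
    (isClosed_Iic.preimage continuous_lintegral_edist).isCompact
  convert (h_compact.image continuous_map_fst_map_snd).isClosed using 1
  ext ⟨μ, ν⟩
  constructor
  · intro h_le
    obtain ⟨γ, h_fst, h_snd, h_cost⟩ := exists_optimal_coupling μ ν
    exact ⟨γ, h_cost.trans_le h_le, Prod.ext (Subtype.ext h_fst) (Subtype.ext h_snd)⟩
  · rintro ⟨γ, h_le, h_eq⟩
    exact (wassersteinDist_le (congrArg (Subtype.val ∘ Prod.fst) h_eq)
      (congrArg (Subtype.val ∘ Prod.snd) h_eq)).trans h_le

theorem measurable_wassersteinDist :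
    Measurable fun p : ProbabilityMeasure X × ProbabilityMeasure X =>
      wassersteinDist (p.1 : Measure X) p.2 :=
  lowerSemicontinuous_wassersteinDist.measurable

end OptimalCoupling

section TreeSpace

variable {k : ℕ}

theorem RayPoint.lipschitzWith_coord : LipschitzWith 1 (RayPoint.coord (k := k)) := by
  refine LipschitzWith.mk_one fun p q => ?_
  have hp := p.mem.1
  have hq := q.mem.1
  change |p.coord - q.coord| ≤ if p.edge = q.edge then |p.coord - q.coord| else
    p.coord + q.coord
  split_ifs <;> grind

/-- The coordinate `t` of a point `(t, i)` of a tree, which is its distance to the root. -/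
def TreeSpace.height : TreeSpace k → ℝ :=
  SeparationQuotient.lift RayPoint.coord fun _ _ h =>
    (h.map RayPoint.lipschitzWith_coord.continuous).eq

theorem TreeSpace.height_mk (i : Fin k) (t : ℝ) (ht : t ∈ Icc 0 π) :
    (TreeSpace.mk i t ht).height = t :=
  rfl

theorem TreeSpace.continuous_height : Continuous (TreeSpace.height (k := k)) :=
  SeparationQuotient.continuous_lift RayPoint.lipschitzWith_coord.continuous

theorem TreeSpace.isometry_mk (i : Fin k) : Isometry fun t : Icc 0 π => TreeSpace.mk i t t.2 :=
  Isometry.of_dist_eq fun s t => by rw [TreeSpace.dist_mk, if_pos rfl]; rfl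

instance TreeSpace.instCompactSpace : CompactSpace (TreeSpace k) where
  isCompact_univ := by
    have h_univ : univ = ⋃ i : Fin k, range fun t : Icc 0 π => TreeSpace.mk i t t.2 :=
      (eq_univ_of_forall fun p => by
        obtain ⟨⟨i, t, ht⟩, rfl⟩ := SeparationQuotient.surjective_mk p
        exact mem_iUnion.2 ⟨i, ⟨t, ht⟩, rfl⟩).symm
    rw [h_univ]
    exact isCompact_iUnion fun i => isCompact_range (TreeSpace.isometry_mk i).continuous

end TreeSpace

section Radon

variable {d n k : ℕ} {h : USphere d → USphere n}
  {α : USphere n × SphericalTree n k → stdSimplex ℝ (Fin k)}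

theorem SphericalTree.measurable_root : Measurable (SphericalTree.root (d := n) (k := k)) :=
  measurable_fst.comp measurable_subtype_coe

theorem measurable_uncurry_treeProj (hh : Measurable h) (i : Fin k) :
    Measurable (Function.uncurry fun T : SphericalTree n k => treeProj h T i) := by
  have h_root := SphericalTree.measurable_root (n := n) (k := k)
  have h_arccos : Measurable fun p : SphericalTree n k × USphere d =>
      Real.arccos (inner ℝ (p.1.root : EuclideanSpace ℝ (Fin (n + 1))) (h p.2)) :=
    Real.measurable_arccos.comp (by fun_prop)
  exact (TreeSpace.isometry_mk i).continuous.measurable.comp (h_arccos.subtype_mk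
    (h := fun _ => ⟨Real.arccos_nonneg _, Real.arccos_le_pi _⟩))

theorem measurable_treeProj (hh : Measurable h) (T : SphericalTree n k) (i : Fin k) :
    Measurable (treeProj h T i) :=
  (measurable_uncurry_treeProj hh i).of_uncurry_left

theorem cos_height_treeProj (T : SphericalTree n k) (i : Fin k) (y : USphere d) :
    Real.cos (treeProj h T i y).height =
      inner ℝ (T.root : EuclideanSpace ℝ (Fin (n + 1))) (h y) := by
  have h_le := abs_le.1 (abs_real_inner_le_norm (T.root : EuclideanSpace ℝ (Fin (n + 1))) (h y))
  rw [norm_eq_of_mem_sphere, norm_eq_of_mem_sphere, one_mul] at h_le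
  exact (congrArg Real.cos (TreeSpace.height_mk i _ _)).trans (Real.cos_arccos h_le.1 h_le.2)

theorem measurable_uncurry_splitting (hh : Measurable h) (hα : Measurable α) (i : Fin k) :
    Measurable (Function.uncurry fun (T : SphericalTree n k) y => α (h y, T) i) :=
  (measurable_pi_apply i).comp (measurable_subtype_coe.comp (hα.comp (by fun_prop)))

theorem measurable_splitting (hh : Measurable h) (hα : Measurable α) (T : SphericalTree n k)
    (i : Fin k) : Measurable fun y => α (h y, T) i :=
  (measurable_uncurry_splitting hh hα i).of_uncurry_left

theorem lintegral_spatialRadon (hh : Measurable h) (hα : Measurable α) (T : SphericalTree n k)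
    (μ : Measure (USphere d)) {φ : TreeSpace k → ℝ≥0∞} (hφ : Measurable φ) :
    ∫⁻ p, φ p ∂spatialRadon h α T μ =
      ∑ i, ∫⁻ y, ENNReal.ofReal (α (h y, T) i) * φ (treeProj h T i y) ∂μ := by
  rw [spatialRadon, lintegral_finsetSum_measure]
  refine Finset.sum_congr rfl fun i _ => ?_
  have h_proj := measurable_treeProj hh T i
  exact (lintegral_map hφ h_proj).trans (lintegral_withDensity_eq_lintegral_mul _
    (measurable_splitting hh hα T i).ennreal_ofReal (hφ.comp h_proj))

theorem lintegral_spatialRadon_of_comp_treeProj_eq (hh : Measurable h) (hα : Measurable α)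
    (T : SphericalTree n k) (μ : Measure (USphere d)) {φ : TreeSpace k → ℝ≥0∞} (hφ : Measurable φ)
    {g : USphere d → ℝ≥0∞} (h_eq : ∀ i y, φ (treeProj h T i y) = g y) :
    ∫⁻ p, φ p ∂spatialRadon h α T μ = ∫⁻ y, g y ∂μ := by
  have h_sum (y : USphere d) : ∑ i, ENNReal.ofReal (α (h y, T) i) = 1 := by
    rw [← ENNReal.ofReal_sum_of_nonneg fun i _ => stdSimplex.zero_le _ i,
      stdSimplex.sum_eq_one, ENNReal.ofReal_one]
  calc ∫⁻ p, φ p ∂spatialRadon h α T μ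
      = ∑ i, ∫⁻ y, ENNReal.ofReal (α (h y, T) i) * φ (treeProj h T i y) ∂μ :=
        lintegral_spatialRadon hh hα T μ hφ
    _ = ∫⁻ y, ∑ i, ENNReal.ofReal (α (h y, T) i) * φ (treeProj h T i y) ∂μ :=
        (lintegral_finsetSum _ fun i _ => (measurable_splitting hh hα T i).ennreal_ofReal.mul
          (hφ.comp (measurable_treeProj hh T i))).symm
    _ = ∫⁻ y, g y ∂μ := by simp only [h_eq, ← Finset.sum_mul, h_sum, one_mul]

theorem map_spatialRadon_of_comp_treeProj_eq (hh : Measurable h) (hα : Measurable α)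
    (T : SphericalTree n k) (μ : Measure (USphere d)) {Z : Type*} [MeasurableSpace Z]
    {f : TreeSpace k → Z} (hf : Measurable f) {g : USphere d → Z} (hg : Measurable g)
    (h_eq : ∀ i y, f (treeProj h T i y) = g y) : (spatialRadon h α T μ).map f = μ.map g := by
  ext s hs
  have h_ind : Measurable (s.indicator (1 : Z → ℝ≥0∞)) := measurable_one.indicator hs
  rw [← lintegral_indicator_one hs, ← lintegral_indicator_one hs, lintegral_map h_ind hf,
    lintegral_map h_ind hg]
  exact lintegral_spatialRadon_of_comp_treeProj_eq hh hα T μ (h_ind.comp hf) fun i y =>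
    congrArg (s.indicator 1) (h_eq i y)

theorem isProbabilityMeasure_spatialRadon (hh : Measurable h) (hα : Measurable α)
    (T : SphericalTree n k) (μ : Measure (USphere d)) [IsProbabilityMeasure μ] :
    IsProbabilityMeasure (spatialRadon h α T μ) where
  measure_univ := by
    rw [← lintegral_one, lintegral_spatialRadon_of_comp_treeProj_eq hh hα T μ measurable_const
      fun _ _ => rfl, lintegral_one, measure_univ]

theorem measurable_spatialRadon (hh : Measurable h) (hα : Measurable α) (μ : Measure (USphere d))
    [SFinite μ] : Measurable fun T => spatialRadon h α T μ := by
  refine Measure.measurable_of_measurable_coe _ fun s hs => ?_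
  have h_ind : Measurable (s.indicator (1 : TreeSpace k → ℝ≥0∞)) := measurable_one.indicator hs
  simp only [← lintegral_indicator_one hs, lintegral_spatialRadon hh hα _ μ h_ind]
  refine Finset.measurable_sum _ fun i _ => Measurable.lintegral_prod_right' (f := fun p =>
    ENNReal.ofReal (α (h p.2, p.1) i) *
      s.indicator 1 (treeProj h p.1 i p.2)) ?_
  refine Measurable.mul ?_ (h_ind.comp (measurable_uncurry_treeProj hh i))
  exact (measurable_uncurry_splitting hh hα i).ennreal_ofReal

theorem map_inner_eq_of_spatialRadon_eq (hh : Measurable h) (hα : Measurable α)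
    (T : SphericalTree n k) {μ ν : Measure (USphere d)}
    (h_eq : spatialRadon h α T μ = spatialRadon h α T ν) :
    μ.map (fun y => inner ℝ (T.root : EuclideanSpace ℝ (Fin (n + 1))) (h y)) =
      ν.map fun y => inner ℝ (T.root : EuclideanSpace ℝ (Fin (n + 1))) (h y) := by
  have h_cos : Measurable fun p : TreeSpace k => Real.cos p.height :=
    Real.measurable_cos.comp TreeSpace.continuous_height.measurable
  have h_map (ρ : Measure (USphere d)) := map_spatialRadon_of_comp_treeProj_eq hh hα T ρ h_cos
    (by fun_prop) (cos_height_treeProj T)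
  rw [← h_map, h_eq, h_map]

end Radon

section CramerWold

variable {E : Type*} [NormedAddCommGroup E] [InnerProductSpace ℝ E]

theorem exists_mem_sphere_smul_eq [Nontrivial E] (v : E) :
    ∃ x : Metric.sphere (0 : E) 1, ∃ t : ℝ, t • (x : E) = v := by
  obtain ⟨x, hx⟩ := (NormedSpace.sphere_nonempty (x := (0 : E))).2 zero_le_one
  rcases eq_or_ne v 0 with rfl | hv
  · exact ⟨⟨x, hx⟩, 0, zero_smul _ _⟩
  · exact ⟨⟨‖v‖⁻¹ • v, by simp [norm_smul, hv]⟩, ‖v‖, by simp [hv]⟩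

variable [MeasurableSpace E] [OpensMeasurableSpace E]

theorem charFun_map_inner (μ : Measure E) (x : E) (t : ℝ) :
    charFun (μ.map (inner ℝ x)) t = charFun μ (t • x) := by
  have h_dual :
      t • InnerProductSpace.toDualMap ℝ E x = InnerProductSpace.toDualMap ℝ E (t • x) := by
    simp
  rw [charFun_eq_charFunDual_toDualMap (t • x), ← h_dual, ← charFun_map_eq_charFunDual_smul]
  rfl

theorem eq_of_ae_map_inner_eq [BorelSpace E] [SecondCountableTopology E] [CompleteSpace E]
    [Nontrivial E] {σ : Measure (Metric.sphere (0 : E) 1)} [σ.IsOpenPosMeasure] {μ ν : Measure E}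
    [IsFiniteMeasure μ] [IsFiniteMeasure ν]
    (h : ∀ᵐ x : Metric.sphere (0 : E) 1 ∂σ, μ.map (inner ℝ (x : E)) = ν.map (inner ℝ (x : E))) :
    μ = ν := by
  refine Measure.ext_of_charFun (funext fun v => ?_)
  obtain ⟨x, t, rfl⟩ := exists_mem_sphere_smul_eq v
  have h_ae : (fun x : Metric.sphere (0 : E) 1 => charFun μ (t • (x : E))) =ᵐ[σ]
      fun x => charFun ν (t • (x : E)) := by
    filter_upwards [h] with x hx
    rw [← charFun_map_inner, hx, charFun_map_inner]
  exact congrFun (Measure.eq_of_ae_eq h_ae (continuous_charFun.comp (by fun_prop))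
    (continuous_charFun.comp (by fun_prop))) x

end CramerWold

section Sampling

instance uniformUnitSphere.instIsProbabilityMeasure (m : ℕ) [NeZero m] :
    IsProbabilityMeasure (uniformUnitSphere m) where
  measure_univ := ENNReal.inv_mul_cancel
    (Measure.measure_univ_ne_zero.2 (Measure.toSphere_ne_zero _)) (measure_ne_top _ _)

instance uniformUnitSphere.instIsOpenPosMeasure (m : ℕ) : (uniformUnitSphere m).IsOpenPosMeasure :=
  Measure.isOpenPosMeasure_smul _ (ENNReal.inv_ne_zero.2 (measure_ne_top _ _))

variable {n k : ℕ}

theorem poleTo_apply (x : USphere n) (v : EuclideanSpace ℝ (Fin (n + 1))) :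
    poleTo x v = v - (2 * (inner ℝ (pole n - (x : EuclideanSpace ℝ (Fin (n + 1)))) v /
      ‖pole n - (x : EuclideanSpace ℝ (Fin (n + 1)))‖ ^ 2)) •
        (pole n - (x : EuclideanSpace ℝ (Fin (n + 1)))) := by
  rw [poleTo, Submodule.reflection_orthogonal_apply, Submodule.reflection_singleton_apply]
  simp [mul_smul, two_smul]

theorem continuous_equator : Continuous (equator (n := n)) := by
  refine (PiLp.continuous_toLp 2 _).comp (continuous_pi fun i => ?_)
  cases i using Fin.cases with
  | zero => exact continuous_const
  | succ j => simpa only [Fin.cons_succ] using by fun_prop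

theorem measurable_treeOf : Measurable (treeOf (n := n) (k := k)) := by
  have h_equator := (continuous_equator (n := n)).measurable
  have h_direction (i : Fin k) : Measurable fun p : USphere n ×
      (Fin k → Metric.sphere (0 : EuclideanSpace ℝ (Fin n)) 1) => poleTo p.1 (equator (p.2 i)) := by
    simp only [poleTo_apply]
    fun_prop
  exact (measurable_fst.prodMk (measurable_pi_lambda _ fun i =>
    (h_direction i).subtype_mk)).subtype_mk

theorem ae_root_of_ae_treeSampling [NeZero n] {p : USphere n → Prop}
    (hp : ∀ᵐ T ∂treeSampling n k, p T.root) : ∀ᵐ x ∂uniformUnitSphere (n + 1), p x := by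
  have h_prod := ae_of_ae_map measurable_treeOf.aemeasurable hp
  filter_upwards [Measure.ae_ae_of_ae_prod h_prod] with x hx
  obtain ⟨_, hz⟩ := hx.exists
  exact hz

instance treeSampling.instIsProbabilityMeasure [NeZero n] :
    IsProbabilityMeasure (treeSampling n k) :=
  Measure.isProbabilityMeasure_map measurable_treeOf.aemeasurable

end Sampling

section Metric

variable {d n k : ℕ} {h : USphere d → USphere n}
  {α : USphere n × SphericalTree n k → stdSimplex ℝ (Fin k)}

theorem measurable_wassersteinDist_spatialRadon (hh : Measurable h) (hα : Measurable α)
    (μ ν : Measure (USphere d)) [IsProbabilityMeasure μ] [IsProbabilityMeasure ν] :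
    Measurable fun T => wassersteinDist (spatialRadon h α T μ) (spatialRadon h α T ν) := by
  have h_prob := isProbabilityMeasure_spatialRadon hh hα
  exact measurable_wassersteinDist.comp
    (((measurable_spatialRadon hh hα μ).subtype_mk (h := fun T => h_prob T μ)).prodMk
      ((measurable_spatialRadon hh hα ν).subtype_mk (h := fun T => h_prob T ν)))

theorem spatialSTSW_lt_top [NeZero n] (hh : Measurable h) (hα : Measurable α)
    (μ ν : ProbabilityMeasure (USphere d)) : spatialSTSW h α μ ν < ∞ := by
  have h_prob := isProbabilityMeasure_spatialRadon hh hα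
  calc spatialSTSW h α μ ν ≤ ∫⁻ _, Metric.ediam (univ : Set (TreeSpace k)) ∂treeSampling n k :=
        lintegral_mono fun T => wassersteinDist_le_ediam_univ _ _
    _ < ∞ := by simpa using ediam_univ_lt_top (TreeSpace k)

theorem spatialSTSW_self (h : USphere d → USphere n)
    (α : USphere n × SphericalTree n k → stdSimplex ℝ (Fin k))
    (μ : ProbabilityMeasure (USphere d)) : spatialSTSW h α μ μ = 0 := by
  simp [spatialSTSW, wassersteinDist_self]

theorem spatialSTSW_comm (h : USphere d → USphere n)
    (α : USphere n × SphericalTree n k → stdSimplex ℝ (Fin k))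
    (μ ν : ProbabilityMeasure (USphere d)) : spatialSTSW h α μ ν = spatialSTSW h α ν μ := by
  simp only [spatialSTSW, wassersteinDist_comm (spatialRadon h α _ μ)]

theorem spatialSTSW_triangle (hh : Measurable h) (hα : Measurable α)
    (μ ν ρ : ProbabilityMeasure (USphere d)) :
    spatialSTSW h α μ ρ ≤ spatialSTSW h α μ ν + spatialSTSW h α ν ρ := by
  have h_prob := isProbabilityMeasure_spatialRadon hh hα
  rw [spatialSTSW, spatialSTSW, spatialSTSW,
    ← lintegral_add_left (measurable_wassersteinDist_spatialRadon hh hα μ ν)]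
  exact lintegral_mono fun T => wassersteinDist_triangle _ _ _

theorem eq_of_spatialSTSW_eq_zero [NeZero n] (hh : Measurable h) (h_inj : Function.Injective h)
    (hα : Measurable α) {μ ν : ProbabilityMeasure (USphere d)} (h_zero : spatialSTSW h α μ ν = 0) :
    μ = ν := by
  have h_prob := isProbabilityMeasure_spatialRadon hh hα
  let ι : USphere d → EuclideanSpace ℝ (Fin (n + 1)) := fun y => h y
  have hι : MeasurableEmbedding ι :=
    (measurable_subtype_coe.comp hh).measurableEmbedding (Subtype.val_injective.comp h_inj)
  have h_radon : ∀ᵐ T ∂treeSampling n k, spatialRadon h α T μ = spatialRadon h α T ν := by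
    filter_upwards [(lintegral_eq_zero_iff
      (measurable_wassersteinDist_spatialRadon hh hα μ ν)).1 h_zero] with T hT
    exact eq_of_wassersteinDist_eq_zero hT
  have h_inner : ∀ᵐ x : USphere n ∂uniformUnitSphere (n + 1),
      ((μ : Measure (USphere d)).map ι).map (inner ℝ (x : EuclideanSpace ℝ (Fin (n + 1)))) =
        ((ν : Measure (USphere d)).map ι).map (inner ℝ (x : EuclideanSpace ℝ (Fin (n + 1)))) := by
    refine ae_root_of_ae_treeSampling (k := k) ?_
    filter_upwards [h_radon] with T hT
    rw [Measure.map_map (by fun_prop) hι.measurable, Measure.map_map (by fun_prop) hι.measurable]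
    exact map_inner_eq_of_spatialRadon_eq hh hα T hT
  have h_map := eq_of_ae_map_inner_eq h_inner
  exact Subtype.ext (hι.map_injective h_map)

end Metric

theorem mainTheorem5_general (d n k : ℕ) (hn : 0 < n)
    (h : USphere d → USphere n) (hh : Measurable h) (h_inj : Function.Injective h)
    (α : USphere n × SphericalTree n k → stdSimplex ℝ (Fin k)) (hα : Measurable α) :
    (∀ μ ν : ProbabilityMeasure (USphere d),
      Measurable fun T : SphericalTree n k =>
        wassersteinDist (spatialRadon h α T μ) (spatialRadon h α T ν)) ∧
    (∀ (μ ν : ProbabilityMeasure (USphere d)) (T : SphericalTree n k),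
      wassersteinDist (spatialRadon h α T μ) (spatialRadon h α T ν) < ∞) ∧
    (∀ μ ν : ProbabilityMeasure (USphere d), spatialSTSW h α μ ν < ∞) ∧
    (∀ μ ν : ProbabilityMeasure (USphere d), spatialSTSW h α μ ν = 0 ↔ μ = ν) ∧
    (∀ μ ν : ProbabilityMeasure (USphere d), spatialSTSW h α μ ν = spatialSTSW h α ν μ) ∧
    (∀ μ ν ρ : ProbabilityMeasure (USphere d),
      spatialSTSW h α μ ρ ≤ spatialSTSW h α μ ν + spatialSTSW h α ν ρ) := by
  have : NeZero n := ⟨hn.ne'⟩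
  have h_prob := isProbabilityMeasure_spatialRadon hh hα
  exact ⟨fun μ ν => measurable_wassersteinDist_spatialRadon hh hα μ ν,
    fun _ _ _ => wassersteinDist_lt_top _ _, spatialSTSW_lt_top hh hα,
    fun μ ν => ⟨eq_of_spatialSTSW_eq_zero hh h_inj hα, fun h_eq => h_eq ▸ spatialSTSW_self h α μ⟩,
    spatialSTSW_comm h α, spatialSTSW_triangle hh hα⟩

theorem mainTheorem5 (d n k : ℕ) (hd : 0 < d) (hn : 0 < n) (hk : 0 < k)
    (h : USphere d → USphere n) (h_cont : Continuous h) (h_inj : Function.Injective h)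
    (α : USphere n × SphericalTree n k → stdSimplex ℝ (Fin k)) (α_cont : Continuous α) :
    -- the integrand that defines the distance is measurable and finite
    (∀ μ ν : ProbabilityMeasure (USphere d),
      Measurable fun T : SphericalTree n k =>
        wassersteinDist (spatialRadon h α T μ) (spatialRadon h α T ν)) ∧
    (∀ (μ ν : ProbabilityMeasure (USphere d)) (T : SphericalTree n k),
      wassersteinDist (spatialRadon h α T μ) (spatialRadon h α T ν) < ∞) ∧
    -- the distance is a metric
    (∀ μ ν : ProbabilityMeasure (USphere d), spatialSTSW h α μ ν < ∞) ∧
    (∀ μ ν : ProbabilityMeasure (USphere d), spatialSTSW h α μ ν = 0 ↔ μ = ν) ∧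
    (∀ μ ν : ProbabilityMeasure (USphere d), spatialSTSW h α μ ν = spatialSTSW h α ν μ) ∧
    (∀ μ ν ρ : ProbabilityMeasure (USphere d),
      spatialSTSW h α μ ρ ≤ spatialSTSW h α μ ν + spatialSTSW h α ν ρ) :=
  mainTheorem5_general d n k hn h h_cont.measurable h_inj α α_cont.measurable
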